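/- Let $X_1,X_2,\dots$ be i.i.d. with a regular density $f(x\mid\theta)$, where $\theta=(\theta_{(1)},\dots,\theta_{(m)})$ is an ordered grouping of the parameters, $\theta_{(i)}$ has dimension $q_i$, and $\theta$ ranges over $\Theta=\Theta_1\times\cdots\times\Theta_m$, a nonempty open set. Regular means: for $\theta\in\Theta$ the support of $f(\cdot\mid\theta)$ does not depend on $\theta$, $f$ is differentiable in $\theta$, $\int\partial_\theta f(x\mid\theta)\,d\mu(x)=0$, and the Fisher information matrix $\mathbf I(\theta)$ of one observation is finite and positive definite. Let $N\ge 1$ be a proper stopping time for the sequence of observations. Suppose that for all $\theta\in\Theta$ $$\mathbf I(\theta)=\operatorname{diag}\Big(\prod_{i=1}^m\mathbf G_{1i}(\theta_{(i)}),\dots,\prod_{i=1}^m\mathbf G_{mi}(\theta_{(i)})\Big),\qquad E_\theta(N)=\prod_{i=1}^m g_i(\theta_{(i)})<\infty,$$ where $\mathbf G_{li}$ is a $q_l\times q_l$ matrix, and that $q_i=2$ for all $i$. For an experiment with likelihood $L(\theta)$ the Fisher information matrix is $\big(E_\theta[\partial_a\log L\,\partial_b\log L]\big)_{a,b}$; for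 the sequential experiment $L(\theta)=\prod_{i=1}^N f(X_i\mid\theta)$, and its Fisher information is denoted $\mathbf I^*(\theta)$. Reference priors are those of the Berger–Bernardo ordered group algorithm. Given a Fisher information matrix, let $S$ be its inverse, $S_j$ the upper left corner of $S$ belonging to the groups $1,\dots,j$, and $h_j(\theta)$ the lower right $q_j\times q_j$ corner of $S_j^{-1}$. On a product of compact sets $K=K_1\times\cdots\times K_m$ put $\pi_{m+1}=1$ and, for $j=m,\dots,1$, $$\pi_j(\theta_{(j)},\dots,\theta_{(m)}\mid\theta_{(1)},\dots,\theta_{(j-1)})=\pi_{j+1}(\theta_{(j+1)},\dots,\theta_{(m)}\mid\theta_{(1)},\dots,\theta_{(j)})\,\frac{w_j\,1_{K_j}(\theta_{(j)})}{\int_{K_j}w_j\,d\theta_{(j)}},$$ $$w_j=w_j(\theta_{(1)},\dots,\theta_{(j)})=\exp\Big\{\tfrac12\int_{K_{j+1}\times\cdots\times K_m}\log|h_j(\theta)|\;\pi_{j+1}\;d\theta_{(j+1)}\cdots d\theta_{(m)}\Big\};$$ $\pi^K=\pi_1$ is the reference prior on $K$. For compact sets $K^l=K^l_1\times\cdots\times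 K^l_m$ with $K_i^l$ increasing in $l$ to $\Theta_i$, the reference prior on $\Theta$ is $\lim_{l\to\infty}\pi^{K^l}(\theta)/\pi^{K^l}(\theta_0)$, where $\theta_0\in\Theta$ is a fixed point with $\pi^{K^l}(\theta_0)>0$ for all large $l$; it is determined up to a positive constant factor. Fix such sets $K^l$, and suppose that for all large $l$ the construction makes sense on $K^l$ both for $\mathbf I$ and for $\mathbf I^*$, that is, the integrals in it exist and the normalizing integrals are finite and positive. Then the reference prior $\pi_R$ based on the single observation $X_1$ and the reference prior $\pi_R^*$ of the sequential experiment exist, are unique up to a positive constant factor, and satisfy $$\pi_R(\theta)\propto\prod_{i=1}^m\big|\det\mathbf G_{ii}(\theta_{(i)})\big|^{1/2},\qquad \pi_R^*(\theta)\propto E_\theta(N)\,\pi_R(\theta)\qquad(\theta\in\Theta).$$ -/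

import Mathlib

open MeasureTheory ProbabilityTheory Filter Topology
open scoped ENNReal

/-- The space of parameters `θ = (θ₍₁₎, …, θ₍ₘ₎)` in which the group `θ₍ᵢ₎` has dimension `q i`;
the groups are ordered as the elements of `Fin m`. -/
abbrev Param {m : ℕ} (q : Fin m → ℕ) : Type := (i : Fin m) → Fin (q i) → ℝ

/-- The scalar coordinates of a parameter: the `k`-th coordinate of the `i`-th group. -/
abbrev Coord {m : ℕ} (q : Fin m → ℕ) : Type := (i : Fin m) × Fin (q i)

section Model

variable {m : ℕ} {q : Fin m → ℕ} {Ω 𝓧 : Type*}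

/-- The coordinate vector of the parameter space in the direction of the coordinate `a`. -/
def coordVec (a : Coord q) : Param q := Pi.single a.1 (Pi.single a.2 1)

/-- The score `∂ log L(θ; ω) / ∂θ_a` of a likelihood function `L`. -/
noncomputable def score (L : Param q → Ω → ℝ) (θ : Param q) (ω : Ω) (a : Coord q) : ℝ :=
  fderiv ℝ (fun ϑ => Real.log (L ϑ ω)) θ (coordVec a)

/-- The Fisher information matrix at `θ` of an experiment with likelihood `L`, whose outcome has
the law `P θ`: the matrix of the expectations `E_θ (∂_a log L · ∂_b log L)`. -/
noncomputable def fisherInfo [MeasurableSpace Ω] (P : Param q → Measure Ω)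
    (L : Param q → Ω → ℝ) (θ : Param q) : Matrix (Coord q) (Coord q) ℝ :=
  fun a b => ∫ ω, score L θ ω a * score L θ ω b ∂(P θ)

/-- The law with density `f(· | θ)` with respect to the dominating measure `μ`. -/
noncomputable def densityLaw [MeasurableSpace 𝓧] (μ : Measure 𝓧) (f : Param q → 𝓧 → ℝ)
    (θ : Param q) : Measure 𝓧 :=
  μ.withDensity (fun x => ENNReal.ofReal (f θ x))

/-- A regular family of densities `f(x | θ)`, `θ ∈ Θ`, with respect to `μ`: a common support,
differentiability in `θ`, differentiation of the total mass under the integral sign, and a finite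
positive definite Fisher information matrix. -/
structure IsRegularFamily [MeasurableSpace 𝓧] (μ : Measure 𝓧) (Θ : Set (Param q))
    (f : Param q → 𝓧 → ℝ) : Prop where
  isOpen : IsOpen Θ
  nonneg : ∀ θ ∈ Θ, ∀ x, 0 ≤ f θ x
  measurable : ∀ θ ∈ Θ, Measurable (f θ)
  lintegral_eq_one : ∀ θ ∈ Θ, ∫⁻ x, ENNReal.ofReal (f θ x) ∂μ = 1
  common_support : ∀ θ ∈ Θ, ∀ θ' ∈ Θ, ∀ x, 0 < f θ x ↔ 0 < f θ' x
  differentiableAt : ∀ θ ∈ Θ, ∀ x, DifferentiableAt ℝ (fun ϑ => f ϑ x) θ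
  integral_deriv_eq_zero : ∀ θ ∈ Θ, ∀ a : Coord q,
    ∫ x, fderiv ℝ (fun ϑ => f ϑ x) θ (coordVec a) ∂μ = 0
  score_memLp : ∀ θ ∈ Θ, ∀ a : Coord q, MemLp (fun x => score f θ x a) 2 (densityLaw μ f θ)
  posDef : ∀ θ ∈ Θ, (fisherInfo (densityLaw μ f) f θ).PosDef

/-- Under each `Pr θ` with `θ ∈ Θ`, the observations `X 0, X 1, …` are independent and identically
distributed with density `f(· | θ)`. -/
structure IsIIDSample [MeasurableSpace Ω] [MeasurableSpace 𝓧] (μ : Measure 𝓧)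
    (Θ : Set (Param q)) (f : Param q → 𝓧 → ℝ) (Pr : Param q → Measure Ω) (X : ℕ → Ω → 𝓧) :
    Prop where
  isProbabilityMeasure : ∀ θ ∈ Θ, IsProbabilityMeasure (Pr θ)
  indep : ∀ θ ∈ Θ, iIndepFun X (Pr θ)
  law : ∀ θ ∈ Θ, ∀ n, (Pr θ).map (X n) = densityLaw μ f θ

/-- The filtration of the observations: at time `n` the first `n` observations
`X 0, …, X (n - 1)` are known. -/
def obsFiltration [mΩ : MeasurableSpace Ω] [m𝓧 : MeasurableSpace 𝓧] (X : ℕ → Ω → 𝓧)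
    (hX : ∀ n, Measurable (X n)) : Filtration ℕ mΩ where
  seq n := ⨆ i : Fin n, m𝓧.comap (X i)
  mono' := fun _ n h => iSup_le fun i =>
    le_iSup (fun j : Fin n => m𝓧.comap (X j)) ⟨i, i.2.trans_le h⟩
  le' := fun _ => iSup_le fun i => (hX i).comap_le

/-- A proper stopping time of the sequential experiment: it takes at least one observation, the
decision to stop after `n` observations depends on these only, and sampling terminates almost
surely under every parameter. -/
structure IsProperStoppingTime [MeasurableSpace Ω] [MeasurableSpace 𝓧] (Θ : Set (Param q))
    (Pr : Param q → Measure Ω) (X : ℕ → Ω → 𝓧) (hX : ∀ n, Measurable (X n)) (N : Ω → ℕ∞) :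
    Prop where
  isStoppingTime : IsStoppingTime (obsFiltration X hX) N
  one_le : ∀ ω, 1 ≤ N ω
  ae_finite : ∀ θ ∈ Θ, ∀ᵐ ω ∂(Pr θ), N ω ≠ ⊤

/-- The expected stopping time `E_θ(N)`, which may be infinite. -/
noncomputable def expectedStop [MeasurableSpace Ω] (Pr : Param q → Measure Ω) (N : Ω → ℕ∞)
    (θ : Param q) : ℝ≥0∞ :=
  ∫⁻ ω, (N ω : ℝ≥0∞) ∂(Pr θ)

/-- The likelihood of the data `(X_1, …, X_N)` of the sequential experiment. -/
noncomputable def seqLikelihood (f : Param q → 𝓧 → ℝ) (X : ℕ → Ω → 𝓧) (N : Ω → ℕ∞)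
    (θ : Param q) (ω : Ω) : ℝ :=
  ∏ i ∈ Finset.range (N ω).toNat, f θ (X i ω)

end Model

section ReferencePrior

/-! The ordered group reference prior of Berger and Bernardo for an experiment with Fisher
information matrix `I(θ)`, run on product sets `K = K₁ × ⋯ × Kₘ`. -/

variable {m : ℕ} {q : Fin m → ℕ}

/-- `H_j = S_j⁻¹`, where `S_j` is the upper left corner of `S = I⁻¹` that belongs to the groups
`1, …, j`. -/
noncomputable def cornerInv (I : Matrix (Coord q) (Coord q) ℝ) (j : Fin m) :
    Matrix {a : Coord q // a.1 ≤ j} {a : Coord q // a.1 ≤ j} ℝ :=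
  (I⁻¹.submatrix Subtype.val Subtype.val)⁻¹

/-- `h_j`, the lower right `q_j × q_j` corner of `H_j`. -/
noncomputable def cornerBlock (I : Matrix (Coord q) (Coord q) ℝ) (j : Fin m) :
    Matrix (Fin (q j)) (Fin (q j)) ℝ :=
  (cornerInv I j).submatrix (fun k => ⟨⟨j, k⟩, le_rfl⟩) (fun k => ⟨⟨j, k⟩, le_rfl⟩)

/-- The parameter with the groups of `θ` up to `j` and the groups of `y` after `j`. -/
def glue (j : Fin m) (θ : Param q) (y : (i : {i : Fin m // j < i}) → Fin (q i) → ℝ) : Param q :=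
  fun i => if h : j < i then y ⟨i, h⟩ else θ i

/-- The box of all values in `K` of the groups after `j`. -/
def tailBox (K : (i : Fin m) → Set (Fin (q i) → ℝ)) (j : Fin m) :
    Set ((i : {i : Fin m // j < i}) → Fin (q i) → ℝ) :=
  Set.univ.pi fun i => K i

/-- The integrand `log |h_j(θ)| · π(θ₍ⱼ₊₁₎, …, θ₍ₘ₎ | θ₍₁₎, …, θ₍ⱼ₎)`, as a function of the groups
after `j`. -/
noncomputable def tailIntegrand (I : Param q → Matrix (Coord q) (Coord q) ℝ) (j : Fin m)
    (next : Param q → ℝ) (θ : Param q) (y : (i : {i : Fin m // j < i}) → Fin (q i) → ℝ) : ℝ :=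
  Real.log (cornerBlock (I (glue j θ y)) j).det * next (glue j θ y)

/-- `exp (½ E[log |h_j(θ)| | θ₍₁₎, …, θ₍ⱼ₎])`, where the conditional expectation is with respect
to the density `next` of the groups after `j` given the others. For the last group there is
nothing to integrate, and this is `|h_m(θ)|^{1/2}`. -/
noncomputable def refWeight (I : Param q → Matrix (Coord q) (Coord q) ℝ)
    (K : (i : Fin m) → Set (Fin (q i) → ℝ)) (j : Fin m) (next : Param q → ℝ) (θ : Param q) : ℝ :=
  Real.exp ((1 / 2) * ∫ y in tailBox K j, tailIntegrand I j next θ y)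

/-- The density on `K j` of the group `j`, given the preceding groups. -/
noncomputable def refFactor (I : Param q → Matrix (Coord q) (Coord q) ℝ)
    (K : (i : Fin m) → Set (Fin (q i) → ℝ)) (j : Fin m) (next : Param q → ℝ) (θ : Param q) : ℝ :=
  (K j).indicator
    (fun _ => refWeight I K j next θ / ∫ y in K j, refWeight I K j next (Function.update θ j y))
    (θ j)

/-- The conditional reference prior on `K` of the groups `i` with `j ≤ i`, given the preceding
groups, by recursion downwards from the last group:
`π_j = π_{j+1} · (density of the group j given the preceding groups)`. -/
noncomputable def tailPrior (I : Param q → Matrix (Coord q) (Coord q) ℝ)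
    (K : (i : Fin m) → Set (Fin (q i) → ℝ)) (j : Fin (m + 1)) : Param q → ℝ :=
  Fin.reverseInduction (motive := fun _ => Param q → ℝ) (fun _ => 1)
    (fun j next θ => next θ * refFactor I K j next θ) j

/-- The reference prior on the compact set `K₁ × ⋯ × Kₘ`. -/
noncomputable def compactRefPrior (I : Param q → Matrix (Coord q) (Coord q) ℝ)
    (K : (i : Fin m) → Set (Fin (q i) → ℝ)) : Param q → ℝ :=
  tailPrior I K 0

/-- The construction makes sense on `K`: the conditional expectations exist, and the normalizing
integrals are finite and positive. -/
def RefPriorDefined (I : Param q → Matrix (Coord q) (Coord q) ℝ)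
    (K : (i : Fin m) → Set (Fin (q i) → ℝ)) : Prop :=
  ∀ j : Fin m, ∀ θ ∈ Set.univ.pi K,
    IntegrableOn (tailIntegrand I j (tailPrior I K j.succ) θ) (tailBox K j) ∧
    IntegrableOn (fun y => refWeight I K j (tailPrior I K j.succ) (Function.update θ j y)) (K j) ∧
    0 < ∫ y in K j, refWeight I K j (tailPrior I K j.succ) (Function.update θ j y)

/-- An increasing sequence of compact sets with union `S`. -/
structure IsCompactExhaustion {E : Type*} [TopologicalSpace E] (S : Set E) (K : ℕ → Set E) :
    Prop where
  isCompact : ∀ l, IsCompact (K l)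
  mono : Monotone K
  iUnion_eq : ⋃ l, K l = S

/-- `π` is the reference prior on `Θ` of an experiment with Fisher information `I`, up to a
positive constant factor: for some `θ₀ ∈ Θ`, the priors `π^l` on the product sets `K l` satisfy
`π^l(θ) / π^l(θ₀) → c π(θ)` for all `θ ∈ Θ`. -/
def IsReferencePrior (I : Param q → Matrix (Coord q) (Coord q) ℝ) (Θ : Set (Param q))
    (K : ℕ → (i : Fin m) → Set (Fin (q i) → ℝ)) (π : Param q → ℝ) : Prop :=
  (∀ᶠ l in atTop, RefPriorDefined I (K l)) ∧
  ∃ θ₀ ∈ Θ, (∀ᶠ l in atTop, 0 < compactRefPrior I (K l) θ₀) ∧ ∃ c : ℝ, 0 < c ∧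
    ∀ θ ∈ Θ, Tendsto (fun l => compactRefPrior I (K l) θ / compactRefPrior I (K l) θ₀) atTop
      (𝓝 (c * π θ))

end ReferencePrior

/-! Two facts carry the proof. The first is that `I* = E(N) · I`. The score of the stopped sample is
the sum of the scores of the first `N` observations, and these are i.i.d., centred and square
integrable. Wald's second identity (`integral_stopped_sum_mul`) therefore gives
`fisherInfo_seqLikelihood`. Wald's identity itself is Hilbert space geometry: the terms `1{i < N}
u(X_i)` are orthogonal in `L²` because `{i < N}` depends on the observations before `X_i` only, and
the `P(i < N)` add up to `E(N)`.

The second is that a product structure is inherited by the reference prior. For block diagonal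
information `h_j` is the `j`-th block (`cornerBlock_blockDiagonal'`), so `log |h_j|` is a sum of
functions of single groups. Averaging it over a product density of the later groups keeps the term
in `θ_(j)` and turns the others into a constant in `θ_(j)`, which normalization removes
(`exists_refWeight_update`, `tailPrior_eq_prod`). What remains is the square root of the factor of
`|det h_j|` that depends on `θ_(j)`.

Passing to `I*` multiplies `det h_j` by `E(N)^{q_j} = (∏ g_i)^2`. Its factor in `θ_(j)` thus gains
`g_j^2`, and the prior gains `∏ |g_j| = E(N)`. The exponent two is where `q_j = 2` enters. -/

/-! ### Wald's second identity by orthogonality in `L²`. -/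

section Wald

/-- Partial sums of an orthogonal sequence with summable squared norms are Cauchy. -/
theorem cauchySeq_sum_range_of_orthogonal {E : Type*} [NormedAddCommGroup E]
    [InnerProductSpace ℝ E] (T : ℕ → E) (horth : ∀ i j, i ≠ j → inner ℝ (T i) (T j) = 0)
    (hsum : Summable fun i => ‖T i‖ ^ 2) :
    CauchySeq fun n => ∑ i ∈ Finset.range n, T i := by
  have hnorm : ∀ s : Finset ℕ, ‖∑ i ∈ s, T i‖ ^ 2 = ∑ i ∈ s, ‖T i‖ ^ 2 := by
    intro s
    rw [← real_inner_self_eq_norm_sq, sum_inner]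
    refine Finset.sum_congr rfl fun i hi => ?_
    rw [inner_sum, Finset.sum_eq_single i (fun j _ hj => horth i j hj.symm)
      (fun h => absurd hi h), real_inner_self_eq_norm_sq]
  have hc : CauchySeq fun s : Finset ℕ => ∑ i ∈ s, T i := by
    rw [cauchySeq_finset_iff_vanishing_norm]
    intro ε hε
    obtain ⟨s, hs⟩ := (cauchySeq_finset_iff_vanishing_norm.1 hsum.hasSum.cauchySeq)
      (ε ^ 2) (by positivity)
    refine ⟨s, fun t ht => ?_⟩
    have h := hs t ht
    rw [← hnorm, Real.norm_of_nonneg (by positivity)] at h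
    exact lt_of_pow_lt_pow_left₀ 2 hε.le h
  exact hc.comp_tendsto tendsto_finset_range

/-- The `i`-th summand of a sum over the observations up to the stopping time. -/
noncomputable def stoppedTerm {Ω 𝓧 : Type*} (X : ℕ → Ω → 𝓧) (N : Ω → ℕ∞) (u : 𝓧 → ℝ)
    (i : ℕ) : Ω → ℝ :=
  {ω | (i : ℕ∞) < N ω}.indicator fun ω => u (X i ω)

theorem sum_range_stoppedTerm_eq {Ω 𝓧 : Type*} {X : ℕ → Ω → 𝓧} {N : Ω → ℕ∞} {u : 𝓧 → ℝ}
    {ω : Ω} (hω : N ω ≠ ⊤) {n : ℕ} (hn : (N ω).toNat ≤ n) :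
    ∑ i ∈ Finset.range n, stoppedTerm X N u i ω = ∑ i ∈ Finset.range (N ω).toNat, u (X i ω) := by
  obtain ⟨k, hk⟩ := ENat.ne_top_iff_exists.1 hω
  have hk' : (N ω).toNat = k := by simp [← hk]
  rw [hk'] at hn ⊢
  rw [← Finset.sum_subset (Finset.range_mono hn)]
  · refine Finset.sum_congr rfl fun i hi => ?_
    simp only [Finset.mem_range] at hi
    simp [stoppedTerm, Set.indicator, ← hk, hi]
  · intro i _ hi
    simp only [Finset.mem_range] at hi
    simp [stoppedTerm, Set.indicator, ← hk, hi]

variable {Ω 𝓧 : Type*} [MeasurableSpace Ω] [m𝓧 : MeasurableSpace 𝓧]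

/-- Observations are numbered from 0, so `n < N` means that `X n` is taken. It is the complement of
`N ≤ n`, hence decided by `X 0, …, X (n - 1)` alone. -/
theorem measurableSet_lt_stop {X : ℕ → Ω → 𝓧} {hX : ∀ n, Measurable (X n)} {N : Ω → ℕ∞}
    (hN : IsStoppingTime (obsFiltration X hX) N) (n : ℕ) :
    MeasurableSet[obsFiltration X hX n] {ω | (n : ℕ∞) < N ω} := by
  have h := (hN n).compl
  convert h using 1
  ext ω
  exact (not_le (a := N ω) (b := (n : ℕ∞))).symm

theorem indep_obsFiltration {P : Measure Ω} {X : ℕ → Ω → 𝓧} (hX : ∀ n, Measurable (X n))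
    (hind : iIndepFun X P) (n : ℕ) :
    Indep (obsFiltration X hX n) (m𝓧.comap (X n)) P := by
  have h := indep_iSup_of_disjoint (fun i => (hX i).comap_le) hind.iIndep
    (S := Set.Iio n) (T := {n}) (by simp)
  refine indep_of_indep_of_le_right (indep_of_indep_of_le_left h ?_) ?_
  · exact iSup_le fun i => le_iSup₂_of_le (i : ℕ) i.2 le_rfl
  · exact le_iSup₂_of_le n rfl le_rfl

/-- An observation is independent of what depends on the earlier observations only. -/
theorem integral_mul_obs {P : Measure Ω} {X : ℕ → Ω → 𝓧} (hX : ∀ n, Measurable (X n))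
    (hind : iIndepFun X P) {ν : Measure 𝓧} {n : ℕ} (hlaw : P.map (X n) = ν)
    {Y : Ω → ℝ} (hY : Measurable[obsFiltration X hX n] Y) {w : 𝓧 → ℝ} (hw : Measurable w) :
    ∫ ω, Y ω * w (X n ω) ∂P = (∫ ω, Y ω ∂P) * ∫ x, w x ∂ν := by
  have hi : IndepFun Y (fun ω => w (X n ω)) P := by
    rw [IndepFun_iff_Indep]
    refine indep_of_indep_of_le_right
      (indep_of_indep_of_le_left (indep_obsFiltration hX hind n) hY.comap_le) ?_
    change MeasurableSpace.comap (w ∘ X n) _ ≤ _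
    rw [← MeasurableSpace.comap_comp]
    exact MeasurableSpace.comap_mono hw.comap_le
  -- Independence gives this product formula from measurability alone; no integrability is needed.
  rw [hi.integral_fun_mul_eq_mul_integral
    (hY.mono ((obsFiltration X hX).le n) le_rfl).aestronglyMeasurable
    (hw.comp (hX n)).aestronglyMeasurable, ← hlaw,
    integral_map (hX n).aemeasurable hw.aestronglyMeasurable]

section

variable {P : Measure Ω} {X : ℕ → Ω → 𝓧} {hX : ∀ n, Measurable (X n)} {ν : Measure 𝓧}
  {N : Ω → ℕ∞} {u v : 𝓧 → ℝ}

theorem measurable_obs {i j : ℕ} (hij : i < j) :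
    Measurable[obsFiltration X hX j] (X i) := by
  rw [measurable_iff_comap_le]
  exact le_iSup (fun k : Fin j => m𝓧.comap (X k)) ⟨i, hij⟩

/-- The later observation `X j` is independent of everything else in the integrand, including the
event `j < N`, so the mean zero of `v` factors out. -/
theorem integral_stoppedTerm_mul_of_lt (hind : iIndepFun X P) (hlaw : ∀ n, P.map (X n) = ν)
    (hN : IsStoppingTime (obsFiltration X hX) N) (hu : Measurable u) (hv : Measurable v)
    (hv0 : ∫ x, v x ∂ν = 0) {i j : ℕ} (hij : i < j) :
    ∫ ω, stoppedTerm X N u i ω * stoppedTerm X N v j ω ∂P = 0 := by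
  classical
  have hT : Measurable[obsFiltration X hX j] (stoppedTerm X N u i) :=
    Measurable.indicator (hu.comp (measurable_obs hij))
      ((obsFiltration X hX).mono hij.le _ (measurableSet_lt_stop hN i))
  have h := integral_mul_obs hX hind (hlaw j)
    (Measurable.indicator hT (measurableSet_lt_stop hN j)) hv
  rw [hv0, mul_zero] at h
  rw [← h]
  refine integral_congr_ae (Eventually.of_forall fun ω => ?_)
  by_cases hω : (j : ℕ∞) < N ω <;> simp [stoppedTerm, Set.indicator, hω]

theorem integral_stoppedTerm_mul_self (hind : iIndepFun X P) (hlaw : ∀ n, P.map (X n) = ν)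
    (hN : IsStoppingTime (obsFiltration X hX) N) (hu : Measurable u) (hv : Measurable v) (i : ℕ) :
    ∫ ω, stoppedTerm X N u i ω * stoppedTerm X N v i ω ∂P =
      P.real {ω | (i : ℕ∞) < N ω} * ∫ x, u x * v x ∂ν := by
  classical
  have h := integral_mul_obs hX hind (hlaw i)
    (Measurable.indicator (measurable_const (a := (1 : ℝ))) (measurableSet_lt_stop hN i))
    (hu.mul hv)
  rw [integral_indicator ((obsFiltration X hX).le i _ (measurableSet_lt_stop hN i))] at h
  simp only [integral_const, smul_eq_mul, mul_one, measureReal_restrict_apply_univ,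
    Pi.mul_apply] at h
  rw [← h]
  refine integral_congr_ae (Eventually.of_forall fun ω => ?_)
  by_cases hω : (i : ℕ∞) < N ω <;> simp [stoppedTerm, Set.indicator, hω]

theorem memLp_stoppedTerm (hlaw : ∀ n, P.map (X n) = ν)
    (hN : IsStoppingTime (obsFiltration X hX) N) (hu2 : MemLp u 2 ν) (i : ℕ) :
    MemLp (stoppedTerm X N u i) 2 P := by
  have h : MemLp u 2 (P.map (X i)) := by rw [hlaw i]; exact hu2
  exact (h.comp_of_map (hX i).aemeasurable).indicator
    ((obsFiltration X hX).le i _ (measurableSet_lt_stop hN i))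

theorem lintegral_stop_eq_tsum (hN : IsStoppingTime (obsFiltration X hX) N)
    (hfin : ∀ᵐ ω ∂P, N ω ≠ ⊤) :
    ∫⁻ ω, (N ω : ℝ≥0∞) ∂P = ∑' i : ℕ, P {ω | (i : ℕ∞) < N ω} := by
  have hm : ∀ i : ℕ, MeasurableSet {ω | (i : ℕ∞) < N ω} := fun i =>
    (obsFiltration X hX).le i _ (measurableSet_lt_stop hN i)
  have : ∀ᵐ ω ∂P, (N ω : ℝ≥0∞) = ∑' i : ℕ, {ω | (i : ℕ∞) < N ω}.indicator 1 ω := by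
    filter_upwards [hfin] with ω hω
    obtain ⟨n, hn⟩ := ENat.ne_top_iff_exists.1 hω
    rw [tsum_eq_sum (s := Finset.range n)]
    · rw [Finset.sum_congr rfl (g := fun _ => (1 : ℝ≥0∞))]
      · simp [← hn]
      · intro i hi
        simp only [Finset.mem_range] at hi
        simp [Set.indicator, ← hn, hi]
    · intro i hi
      simp only [Finset.mem_range] at hi
      simp [Set.indicator, ← hn, hi]
  rw [lintegral_congr_ae this, lintegral_tsum fun i => (measurable_one.indicator (hm i)).aemeasurable]
  exact tsum_congr fun i => lintegral_indicator_one (hm i)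

theorem hasSum_measureReal_lt_stop [IsFiniteMeasure P] (hN : IsStoppingTime (obsFiltration X hX) N)
    (hfin : ∀ᵐ ω ∂P, N ω ≠ ⊤) (hE : ∫⁻ ω, (N ω : ℝ≥0∞) ∂P ≠ ⊤) :
    HasSum (fun i : ℕ => P.real {ω | (i : ℕ∞) < N ω}) (∫⁻ ω, (N ω : ℝ≥0∞) ∂P).toReal := by
  rw [lintegral_stop_eq_tsum hN hfin] at hE ⊢
  rw [ENNReal.tsum_toReal_eq fun i => measure_ne_top _ _]
  exact (ENNReal.summable_toReal hE).hasSum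

variable [IsProbabilityMeasure P]

/-- The stopped sums converge in `L²` to the sum over all observations up to the stopping time. -/
theorem exists_tendsto_sum_stoppedTerm (hind : iIndepFun X P) (hlaw : ∀ n, P.map (X n) = ν)
    (hN : IsStoppingTime (obsFiltration X hX) N) (hfin : ∀ᵐ ω ∂P, N ω ≠ ⊤)
    (hE : ∫⁻ ω, (N ω : ℝ≥0∞) ∂P ≠ ⊤) (hu : Measurable u)
    (hu2 : MemLp u 2 ν) (hu0 : ∫ x, u x ∂ν = 0) :
    ∃ U : Lp ℝ 2 P, Tendsto (fun n => ∑ i ∈ Finset.range n,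
        (memLp_stoppedTerm hlaw hN hu2 i).toLp) atTop (𝓝 U) ∧
      U =ᵐ[P] fun ω => ∑ i ∈ Finset.range (N ω).toNat, u (X i ω) := by
  have hinner : ∀ i j, inner ℝ (memLp_stoppedTerm hlaw hN hu2 i).toLp
      (memLp_stoppedTerm hlaw hN hu2 j).toLp =
      ∫ ω, stoppedTerm X N u i ω * stoppedTerm X N u j ω ∂P := by
    intro i j
    rw [L2.inner_def]
    refine integral_congr_ae ?_
    filter_upwards [(memLp_stoppedTerm hlaw hN hu2 i).coeFn_toLp,
      (memLp_stoppedTerm hlaw hN hu2 j).coeFn_toLp] with ω h1 h2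
    simp [h1, h2, mul_comm]
  have hcauchy := cauchySeq_sum_range_of_orthogonal
    (fun i => (memLp_stoppedTerm hlaw hN hu2 i).toLp) (fun i j hij => by
      rw [hinner]
      rcases lt_or_gt_of_ne hij with h | h
      · exact integral_stoppedTerm_mul_of_lt hind hlaw hN hu hu hu0 h
      · simp_rw [mul_comm (stoppedTerm X N u i _)]
        exact integral_stoppedTerm_mul_of_lt hind hlaw hN hu hu hu0 h) (by
      simp_rw [← real_inner_self_eq_norm_sq, hinner,
        integral_stoppedTerm_mul_self hind hlaw hN hu hu]
      exact (hasSum_measureReal_lt_stop hN hfin hE).summable.mul_right _)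
  obtain ⟨U, hU⟩ := cauchySeq_tendsto_of_complete hcauchy
  refine ⟨U, hU, ?_⟩
  -- The partial sums converge in measure both to `U` and to the stopped sum: pointwise they are
  -- eventually constant, since `N` is almost surely finite.
  refine tendstoInMeasure_ae_unique (tendstoInMeasure_of_tendsto_Lp hU) ?_
  refine tendstoInMeasure_of_tendsto_ae (fun n => Lp.aestronglyMeasurable _) ?_
  have hall : ∀ᵐ ω ∂P, ∀ n, (∑ i ∈ Finset.range n, (memLp_stoppedTerm hlaw hN hu2 i).toLp :
      Lp ℝ 2 P) ω = ∑ i ∈ Finset.range n, stoppedTerm X N u i ω := by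
    rw [ae_all_iff]
    intro n
    have h1 : ∀ᵐ ω ∂P, ∀ i, (memLp_stoppedTerm hlaw hN hu2 i).toLp (stoppedTerm X N u i) ω =
        stoppedTerm X N u i ω :=
      ae_all_iff.2 fun i => (memLp_stoppedTerm hlaw hN hu2 i).coeFn_toLp
    filter_upwards [h1, Lp.coeFn_finsetSum (Finset.range n)
      fun i => (memLp_stoppedTerm hlaw hN hu2 i).toLp] with ω h1 h2
    rw [h2, Finset.sum_apply]
    exact Finset.sum_congr rfl fun i _ => h1 i
  filter_upwards [hall, hfin] with ω h1 h2
  refine tendsto_const_nhds.congr' ?_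
  filter_upwards [eventually_ge_atTop (N ω).toNat] with n hn
  rw [h1, sum_range_stoppedTerm_eq h2 hn]

/-- Both stopped sums are `L²` limits and the inner product is continuous. Orthogonality leaves only
the diagonal terms `P(i < N) ∫ u v`. -/
theorem integral_stopped_sum_mul_of_measurable (hind : iIndepFun X P)
    (hlaw : ∀ n, P.map (X n) = ν)
    (hN : IsStoppingTime (obsFiltration X hX) N) (hfin : ∀ᵐ ω ∂P, N ω ≠ ⊤)
    (hE : ∫⁻ ω, (N ω : ℝ≥0∞) ∂P ≠ ⊤) (hu : Measurable u) (hv : Measurable v)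
    (hu2 : MemLp u 2 ν) (hv2 : MemLp v 2 ν) (hu0 : ∫ x, u x ∂ν = 0) (hv0 : ∫ x, v x ∂ν = 0) :
    ∫ ω, (∑ i ∈ Finset.range (N ω).toNat, u (X i ω)) *
        (∑ i ∈ Finset.range (N ω).toNat, v (X i ω)) ∂P =
      (∫⁻ ω, (N ω : ℝ≥0∞) ∂P).toReal * ∫ x, u x * v x ∂ν := by
  obtain ⟨U, hU, hU'⟩ := exists_tendsto_sum_stoppedTerm hind hlaw hN hfin hE hu hu2 hu0
  obtain ⟨V, hV, hV'⟩ := exists_tendsto_sum_stoppedTerm hind hlaw hN hfin hE hv hv2 hv0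
  have hinner : ∀ i j, inner ℝ (memLp_stoppedTerm hlaw hN hu2 i).toLp
      (memLp_stoppedTerm hlaw hN hv2 j).toLp =
      ∫ ω, stoppedTerm X N u i ω * stoppedTerm X N v j ω ∂P := by
    intro i j
    rw [L2.inner_def]
    refine integral_congr_ae ?_
    filter_upwards [(memLp_stoppedTerm hlaw hN hu2 i).coeFn_toLp,
      (memLp_stoppedTerm hlaw hN hv2 j).coeFn_toLp] with ω h1 h2
    simp [h1, h2, mul_comm]
  have h1 : ∫ ω, (∑ i ∈ Finset.range (N ω).toNat, u (X i ω)) *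
        (∑ i ∈ Finset.range (N ω).toNat, v (X i ω)) ∂P = inner ℝ U V := by
    rw [L2.inner_def]
    refine integral_congr_ae ?_
    filter_upwards [hU', hV'] with ω h1 h2
    simp [h1, h2, mul_comm]
  rw [h1]
  refine tendsto_nhds_unique (hU.inner hV) ?_
  refine ((hasSum_measureReal_lt_stop hN hfin hE).mul_right
    (∫ x, u x * v x ∂ν)).tendsto_sum_nat.congr fun n => ?_
  rw [sum_inner]
  refine Finset.sum_congr rfl fun i hi => ?_
  rw [inner_sum, Finset.sum_eq_single i]
  · rw [hinner, integral_stoppedTerm_mul_self hind hlaw hN hu hv]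
  · intro j _ hij
    rw [hinner]
    rcases lt_or_gt_of_ne hij with h | h
    · simp_rw [mul_comm (stoppedTerm X N u i _)]
      exact integral_stoppedTerm_mul_of_lt hind hlaw hN hv hu hu0 h
    · exact integral_stoppedTerm_mul_of_lt hind hlaw hN hu hv hv0 h
  · exact fun h => absurd hi h

/-- Wald's second identity, for two sums over the observations up to a stopping time. -/
theorem integral_stopped_sum_mul (hind : iIndepFun X P) (hlaw : ∀ n, P.map (X n) = ν)
    (hN : IsStoppingTime (obsFiltration X hX) N) (hfin : ∀ᵐ ω ∂P, N ω ≠ ⊤)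
    (hE : ∫⁻ ω, (N ω : ℝ≥0∞) ∂P ≠ ⊤)
    (hu2 : MemLp u 2 ν) (hv2 : MemLp v 2 ν) (hu0 : ∫ x, u x ∂ν = 0) (hv0 : ∫ x, v x ∂ν = 0) :
    ∫ ω, (∑ i ∈ Finset.range (N ω).toNat, u (X i ω)) *
        (∑ i ∈ Finset.range (N ω).toNat, v (X i ω)) ∂P =
      (∫⁻ ω, (N ω : ℝ≥0∞) ∂P).toReal * ∫ x, u x * v x ∂ν := by
  -- Membership in `L²` gives measurability only up to null sets. Measurable representatives agree
  -- with `u` and `v` along all observations almost surely, as each `X i` has law `ν`.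
  have hum := hu2.aestronglyMeasurable.ae_eq_mk
  have hvm := hv2.aestronglyMeasurable.ae_eq_mk
  have key := integral_stopped_sum_mul_of_measurable hind hlaw hN hfin hE
    hu2.aestronglyMeasurable.stronglyMeasurable_mk.measurable
    hv2.aestronglyMeasurable.stronglyMeasurable_mk.measurable
    ((memLp_congr_ae hum).1 hu2) ((memLp_congr_ae hvm).1 hv2)
    ((integral_congr_ae hum).symm.trans hu0) ((integral_congr_ae hvm).symm.trans hv0)
  have hobs : ∀ {w w' : 𝓧 → ℝ}, w =ᵐ[ν] w' → ∀ᵐ ω ∂P, ∀ i, w (X i ω) = w' (X i ω) := by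
    intro w w' h
    rw [ae_all_iff]
    intro i
    rw [← hlaw i] at h
    exact ae_of_ae_map (hX i).aemeasurable h
  have huv : ∫ x, u x * v x ∂ν = ∫ x, hu2.aestronglyMeasurable.mk u x *
      hv2.aestronglyMeasurable.mk v x ∂ν := integral_congr_ae (hum.mul hvm)
  rw [huv, ← key]
  refine integral_congr_ae ?_
  filter_upwards [hobs hum, hobs hvm] with ω h1 h2
  simp only [h1, h2]

end

end Wald

/-! ### The score and the Fisher information of the stopped sample. -/

section SequentialInformation

variable {m : ℕ} {q : Fin m → ℕ} {Ω 𝓧 : Type*}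

theorem IsRegularFamily.ae_pos [MeasurableSpace 𝓧] {μ : Measure 𝓧} {Θ : Set (Param q)}
    {f : Param q → 𝓧 → ℝ} (hf : IsRegularFamily μ Θ f) {θ : Param q} (hθ : θ ∈ Θ) :
    ∀ᵐ x ∂(densityLaw μ f θ), 0 < f θ x := by
  rw [densityLaw, ae_withDensity_iff (hf.measurable θ hθ).ennreal_ofReal]
  exact Eventually.of_forall fun x hx => ENNReal.ofReal_pos.1 (pos_iff_ne_zero.2 hx)

/-- Where the density vanishes at `θ`, the common support makes it vanish on a neighbourhood, so
both sides are zero. -/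
theorem IsRegularFamily.mul_score [MeasurableSpace 𝓧] {μ : Measure 𝓧} {Θ : Set (Param q)}
    {f : Param q → 𝓧 → ℝ} (hf : IsRegularFamily μ Θ f) {θ : Param q} (hθ : θ ∈ Θ) (x : 𝓧)
    (a : Coord q) :
    f θ x * score f θ x a = fderiv ℝ (fun ϑ => f ϑ x) θ (coordVec a) := by
  by_cases h : f θ x = 0
  · have h0 : (fun ϑ => f ϑ x) =ᶠ[𝓝 θ] fun _ => 0 := by
      filter_upwards [hf.isOpen.mem_nhds hθ] with ϑ hϑ
      refine le_antisymm (not_lt.1 fun hpos => ?_) (hf.nonneg ϑ hϑ x)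
      exact ((hf.common_support ϑ hϑ θ hθ x).1 hpos).ne' h
    rw [h, h0.fderiv_eq]
    simp
  · rw [score, fderiv.log (hf.differentiableAt θ hθ x) h]
    simp [h]

theorem IsRegularFamily.integral_score [MeasurableSpace 𝓧] {μ : Measure 𝓧} {Θ : Set (Param q)}
    {f : Param q → 𝓧 → ℝ} (hf : IsRegularFamily μ Θ f) {θ : Param q} (hθ : θ ∈ Θ)
    (a : Coord q) :
    ∫ x, score f θ x a ∂(densityLaw μ f θ) = 0 := by
  rw [densityLaw, integral_withDensity_eq_integral_toReal_smul
    (hf.measurable θ hθ).ennreal_ofReal (by simp), ← hf.integral_deriv_eq_zero θ hθ a]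
  refine integral_congr_ae (Eventually.of_forall fun x => ?_)
  simp only [ENNReal.toReal_ofReal (hf.nonneg θ hθ x), smul_eq_mul]
  exact hf.mul_score hθ x a

/-- The common support keeps all factors positive near `θ`, so the logarithm of the product splits
on a neighbourhood and can be differentiated termwise. -/
theorem IsRegularFamily.score_seqLikelihood [MeasurableSpace 𝓧] {μ : Measure 𝓧}
    {Θ : Set (Param q)} {f : Param q → 𝓧 → ℝ} (hf : IsRegularFamily μ Θ f) {X : ℕ → Ω → 𝓧}
    (N : Ω → ℕ∞) {θ : Param q} (hθ : θ ∈ Θ) {ω : Ω} (hω : ∀ i, 0 < f θ (X i ω)) (a : Coord q) :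
    score (seqLikelihood f X N) θ ω a =
      ∑ i ∈ Finset.range (N ω).toNat, score f θ (X i ω) a := by
  have h : (fun ϑ => Real.log (seqLikelihood f X N ϑ ω)) =ᶠ[𝓝 θ]
      fun ϑ => ∑ i ∈ Finset.range (N ω).toNat, Real.log (f ϑ (X i ω)) := by
    filter_upwards [hf.isOpen.mem_nhds hθ] with ϑ hϑ
    exact Real.log_prod fun i _ => ((hf.common_support θ hθ ϑ hϑ _).1 (hω i)).ne'
  rw [score, h.fderiv_eq, fderiv_fun_sum fun i _ =>
    (hf.differentiableAt θ hθ _).log (hω i).ne']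
  simp [score]

/-- The Fisher information of the sequential experiment is `E_θ(N)` times that of a single
observation. -/
theorem fisherInfo_seqLikelihood [MeasurableSpace Ω] [MeasurableSpace 𝓧] {μ : Measure 𝓧}
    {Θ : Set (Param q)} {f : Param q → 𝓧 → ℝ} (hf : IsRegularFamily μ Θ f)
    {Pr : Param q → Measure Ω} {X : ℕ → Ω → 𝓧} {hX : ∀ n, Measurable (X n)}
    (hiid : IsIIDSample μ Θ f Pr X) {N : Ω → ℕ∞} (hN : IsProperStoppingTime Θ Pr X hX N)
    {θ : Param q} (hθ : θ ∈ Θ) (hE : expectedStop Pr N θ ≠ ⊤) :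
    fisherInfo Pr (seqLikelihood f X N) θ =
      (expectedStop Pr N θ).toReal • fisherInfo (densityLaw μ f) f θ := by
  have := hiid.isProbabilityMeasure θ hθ
  ext a b
  have hpos : ∀ᵐ ω ∂(Pr θ), ∀ i, 0 < f θ (X i ω) := by
    refine ae_all_iff.2 fun i => ?_
    have h := hf.ae_pos hθ
    rw [← hiid.law θ hθ i] at h
    exact ae_of_ae_map (hX i).aemeasurable h
  have h := integral_stopped_sum_mul (hiid.indep θ hθ) (hiid.law θ hθ) hN.isStoppingTime
    (hN.ae_finite θ hθ) hE (hf.score_memLp θ hθ a) (hf.score_memLp θ hθ b)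
    (hf.integral_score hθ a) (hf.integral_score hθ b)
  rw [Matrix.smul_apply, smul_eq_mul, fisherInfo, fisherInfo, expectedStop, ← h]
  refine integral_congr_ae ?_
  filter_upwards [hpos] with ω hω
  rw [hf.score_seqLikelihood N hθ hω, hf.score_seqLikelihood N hθ hω]

end SequentialInformation

/-! ### The blocks `h_j` for block diagonal information. -/

section BlockDiagonal

variable {m : ℕ} {q : Fin m → ℕ}

theorem blockDiagonal'_mul_inv {A : (l : Fin m) → Matrix (Fin (q l)) (Fin (q l)) ℝ}
    (hA : ∀ l, (A l).det ≠ 0) :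
    Matrix.blockDiagonal' A * Matrix.blockDiagonal' (fun l => (A l)⁻¹) = 1 := by
  rw [← Matrix.blockDiagonal'_mul, ← Matrix.blockDiagonal'_one]
  congr 1
  funext l
  exact Matrix.mul_nonsing_inv _ (hA l).isUnit

/-- Corners do not multiply in general. Here they do, since the entries linking a group up to `j`
with a later one vanish. -/
theorem submatrix_blockDiagonal'_mul (A B : (l : Fin m) → Matrix (Fin (q l)) (Fin (q l)) ℝ)
    (j : Fin m) :
    let e : {a : Coord q // a.1 ≤ j} → Coord q := Subtype.val
    (Matrix.blockDiagonal' A).submatrix e e * (Matrix.blockDiagonal' B).submatrix e e =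
      (Matrix.blockDiagonal' A * Matrix.blockDiagonal' B).submatrix e e := by
  intro e
  ext a b
  simp only [Matrix.mul_apply, Matrix.submatrix_apply, e]
  rw [← Finset.sum_subtype (Finset.univ.filter fun c : Coord q => c.1 ≤ j) (by simp)
    (fun c => Matrix.blockDiagonal' A a.1 c * Matrix.blockDiagonal' B c b.1)]
  refine Finset.sum_subset (Finset.filter_subset _ _) fun c _ hc => ?_
  have hac : a.1.1 ≠ c.1 := by
    rintro h
    exact hc (by simpa [← h] using a.2)
  rw [Matrix.blockDiagonal'_apply, dif_neg hac, zero_mul]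

/-- For a block diagonal information matrix, `h_j` is the `j`-th block. -/
theorem cornerBlock_blockDiagonal' {A : (l : Fin m) → Matrix (Fin (q l)) (Fin (q l)) ℝ}
    (hA : ∀ l, (A l).det ≠ 0) (j : Fin m) :
    cornerBlock (Matrix.blockDiagonal' A) j = A j := by
  have h1 : cornerInv (Matrix.blockDiagonal' A) j =
      (Matrix.blockDiagonal' A).submatrix Subtype.val Subtype.val := by
    rw [cornerInv, Matrix.inv_eq_right_inv (blockDiagonal'_mul_inv hA)]
    apply Matrix.inv_eq_left_inv
    rw [submatrix_blockDiagonal'_mul, blockDiagonal'_mul_inv hA]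
    exact Matrix.submatrix_one _ Subtype.val_injective
  ext k k'
  rw [cornerBlock, h1]
  simp

theorem Matrix.PosDef.det_ne_zero_of_blockDiagonal'
    {A : (l : Fin m) → Matrix (Fin (q l)) (Fin (q l)) ℝ}
    (h : (Matrix.blockDiagonal' A).PosDef) (l : Fin m) : (A l).det ≠ 0 := by
  have h1 := h.submatrix (e := fun k : Fin (q l) => (⟨l, k⟩ : Coord q))
    (fun k k' hk => by simpa using hk)
  have h2 : (Matrix.blockDiagonal' A).submatrix (fun k : Fin (q l) => (⟨l, k⟩ : Coord q))
      (fun k => ⟨l, k⟩) = A l := by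
    ext k k'
    simp
  rw [h2] at h1
  exact h1.det_pos.ne'

end BlockDiagonal

/-! ### Product form of the priors on compact boxes. -/

section ProductPrior

variable {m : ℕ} {q : Fin m → ℕ}

theorem glue_update (j : Fin m) (θ : Param q) (y : Fin (q j) → ℝ)
    (z : (i : {i : Fin m // j < i}) → Fin (q i) → ℝ) :
    glue j (Function.update θ j y) z = Function.update (glue j θ z) j y := by
  funext i
  rcases eq_or_ne i j with rfl | h
  · simp [glue]
  · simp [glue, h]

theorem glue_of_lt {j i : Fin m} (h : j < i) (θ : Param q)
    (z : (i : {i : Fin m // j < i}) → Fin (q i) → ℝ) : glue j θ z i = z ⟨i, h⟩ := by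
  simp [glue, h]

theorem glue_mem_pi {K : (i : Fin m) → Set (Fin (q i) → ℝ)} {j : Fin m} {θ : Param q}
    (hθ : θ ∈ Set.univ.pi K) {z : (i : {i : Fin m // j < i}) → Fin (q i) → ℝ}
    (hz : z ∈ tailBox K j) : glue j θ z ∈ Set.univ.pi K := by
  intro i _
  by_cases h : j < i
  · rw [glue_of_lt h]
    exact hz ⟨i, h⟩ trivial
  · simpa [glue, h] using hθ i trivial

theorem update_mem_pi {K : (i : Fin m) → Set (Fin (q i) → ℝ)} {j : Fin m} {θ : Param q}
    (hθ : θ ∈ Set.univ.pi K) {y : Fin (q j) → ℝ} (hy : y ∈ K j) :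
    Function.update θ j y ∈ Set.univ.pi K := by
  intro i _
  rcases eq_or_ne i j with rfl | h
  · simpa using hy
  · simpa [h] using hθ i trivial

/-- The density on `K` proportional to `s`. -/
noncomputable def normalizedOn {E : Type*} [MeasureSpace E] (s : E → ℝ) (K : Set E) (x : E) : ℝ :=
  s x / ∫ y in K, s y

variable {I : Param q → Matrix (Coord q) (Coord q) ℝ} {K : (i : Fin m) → Set (Fin (q i) → ℝ)}
  {a : (j i : Fin m) → (Fin (q i) → ℝ) → ℝ}

/-- A product of probability densities on the tail box is integrable with integral one. -/
theorem integral_tailBox_prod_normalizedOn {j : Fin m} {s : (i : Fin m) → (Fin (q i) → ℝ) → ℝ}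
    (hs : ∀ i, j < i → IntegrableOn (s i) (K i) ∧ 0 < ∫ y in K i, s i y) :
    IntegrableOn (fun z : (i : {i : Fin m // j < i}) → Fin (q i) → ℝ =>
        ∏ i : {i : Fin m // j < i}, normalizedOn (s i) (K i) (z i)) (tailBox K j) ∧
      ∫ z in tailBox K j, ∏ i : {i : Fin m // j < i}, normalizedOn (s i) (K i) (z i) = 1 := by
  have hr : (volume : Measure ((i : {i : Fin m // j < i}) → Fin (q i) → ℝ)).restrict (tailBox K j)
      = Measure.pi fun i : {i : Fin m // j < i} => volume.restrict (K i) := by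
    rw [tailBox, volume_pi, Measure.restrict_pi_pi]
  rw [IntegrableOn, hr]
  refine ⟨Integrable.fintype_prod_dep fun i => (hs i i.2).1.div_const _, ?_⟩
  rw [integral_fintype_prod_eq_prod (fun (i : {i : Fin m // j < i}) =>
    normalizedOn (s i) (K i))]
  refine Finset.prod_eq_one fun i _ => ?_
  simp only [normalizedOn]
  rw [integral_div, div_self (hs i i.2).2.ne']

/-- If the prior of the later groups is a product density, the weight of the group `j` is, as a
function of this group, proportional to `|a_jj|^{1/2}`. -/
theorem exists_refWeight_update (hKm : ∀ i, MeasurableSet (K i))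
    (hdet : ∀ θ ∈ Set.univ.pi K, ∀ j, (cornerBlock (I θ) j).det = ∏ i, a j i (θ i))
    (ha : ∀ j i, ∀ x ∈ K i, a j i x ≠ 0) {j : Fin m} {next : Param q → ℝ}
    {s : (i : Fin m) → (Fin (q i) → ℝ) → ℝ}
    (hs : ∀ i, j < i → IntegrableOn (s i) (K i) ∧ 0 < ∫ y in K i, s i y)
    (hnext : ∀ θ ∈ Set.univ.pi K,
      next θ = ∏ i : {i : Fin m // j < i}, normalizedOn (s i) (K i) (θ i))
    {θ : Param q} (hθ : θ ∈ Set.univ.pi K)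
    (hint : IntegrableOn (tailIntegrand I j next θ) (tailBox K j)) :
    ∃ C : ℝ, 0 < C ∧ ∀ y ∈ K j,
      refWeight I K j next (Function.update θ j y) = C * √|a j j y| := by
  set R : ((i : {i : Fin m // j < i}) → Fin (q i) → ℝ) → ℝ :=
    fun z => ∏ i : {i : Fin m // j < i}, normalizedOn (s i) (K i) (z i) with hR
  obtain ⟨hRi, hR1⟩ := integral_tailBox_prod_normalizedOn hs
  set F : ((i : {i : Fin m // j < i}) → Fin (q i) → ℝ) → ℝ :=
    fun z => ∑ i ∈ Finset.univ.erase j, Real.log (a j i (glue j θ z i)) with hF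
  have hbox : MeasurableSet (tailBox K j) := MeasurableSet.univ_pi fun i => hKm i
  -- Here `R` is the prior density of the later groups. `F` collects the logarithms of the factors
  -- in the groups other than `j`, and so does not involve `y`.
  have htail : ∀ y ∈ K j, Set.EqOn (tailIntegrand I j next (Function.update θ j y))
      (fun z => Real.log (a j j y) * R z + F z * R z) (tailBox K j) := by
    intro y hy z hz
    have hmem := glue_mem_pi (update_mem_pi hθ hy) hz
    simp only [tailIntegrand]
    rw [hdet _ hmem, hnext _ hmem, Real.log_prod fun i _ => ha j i _ (hmem i trivial),
      ← Finset.add_sum_erase _ _ (Finset.mem_univ j), ← add_mul]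
    congr 2
    · simp [glue]
    · refine Finset.sum_congr rfl fun i hi => ?_
      rw [glue_update, Function.update_of_ne (Finset.ne_of_mem_erase hi)]
    · funext i
      rw [glue_of_lt i.2]
  -- At `y = θ j` the whole integrand is integrable by `hint`; subtracting the multiple of `R`
  -- leaves `F * R`.
  have hFR : IntegrableOn (fun z => F z * R z) (tailBox K j) := by
    have h1 := htail (θ j) (hθ j trivial)
    rw [Function.update_eq_self] at h1
    have h2 := (hint.congr_fun h1 hbox).sub (hRi.const_mul (Real.log (a j j (θ j))))
    refine h2.congr (Eventually.of_forall fun z => ?_)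
    simp [hR]
  refine ⟨Real.exp ((1 / 2) * ∫ z in tailBox K j, F z * R z), Real.exp_pos _, fun y hy => ?_⟩
  rw [refWeight, setIntegral_congr_fun hbox (htail y hy),
    integral_add (hRi.const_mul _) hFR, integral_const_mul, hR1, mul_one, mul_add, Real.exp_add,
    mul_comm]
  congr 1
  -- `Real.log` ignores signs, which is why the absolute value appears.
  rw [Real.sqrt_eq_rpow, Real.rpow_def_of_pos (abs_pos.2 (ha j j y hy)), Real.log_abs, mul_comm]

/-- If the determinants of the `h_j` are products of functions of the single groups, the
conditional reference priors on a product set are products of densities of the single groups. -/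
theorem tailPrior_eq_prod (hKm : ∀ i, MeasurableSet (K i)) (hKne : (Set.univ.pi K).Nonempty)
    (hdef : RefPriorDefined I K)
    (hdet : ∀ θ ∈ Set.univ.pi K, ∀ j, (cornerBlock (I θ) j).det = ∏ i, a j i (θ i))
    (ha : ∀ j i, ∀ x ∈ K i, a j i x ≠ 0) (j : Fin (m + 1)) :
    (∀ θ ∈ Set.univ.pi K, tailPrior I K j θ =
      ∏ i with j ≤ i.castSucc, normalizedOn (fun x => √|a i i x|) (K i) (θ i)) ∧
    ∀ i : Fin m, j ≤ i.castSucc → IntegrableOn (fun x => √|a i i x|) (K i) ∧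
      0 < ∫ x in K i, √|a i i x| := by
  induction j using Fin.reverseInduction with
  | last =>
    refine ⟨fun θ _ => ?_, fun i hi => absurd hi (not_le.2 (Fin.castSucc_lt_last i))⟩
    rw [Finset.prod_eq_one]
    · simp [tailPrior]
    · intro i hi
      exact absurd (Finset.mem_filter.1 hi).2 (not_le.2 (Fin.castSucc_lt_last i))
  | cast j ih =>
    obtain ⟨ih1, ih2⟩ := ih
    have hlt : ∀ i : Fin m, j.succ ≤ i.castSucc ↔ j < i := fun i =>
      Fin.succ_le_castSucc_iff
    have hnext : ∀ θ ∈ Set.univ.pi K, tailPrior I K j.succ θ =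
        ∏ i : {i : Fin m // j < i}, normalizedOn (fun x => √|a i i x|) (K i) (θ i) := by
      intro θ hθ
      rw [ih1 θ hθ]
      exact Finset.prod_subtype _ (by simp [hlt])
        (fun i => normalizedOn (fun x => √|a i i x|) (K i) (θ i))
    have hweight := fun θ (hθ : θ ∈ Set.univ.pi K) => exists_refWeight_update hKm hdet ha
      (fun i hi => ih2 i ((hlt i).2 hi)) hnext hθ (hdef j θ hθ).1
    -- At one point of the box, dividing by `C` transfers integrability and positivity from the
    -- weight to `√|a j j|`.
    have hj : IntegrableOn (fun x => √|a j j x|) (K j) ∧ 0 < ∫ x in K j, √|a j j x| := by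
      obtain ⟨θ, hθ⟩ := hKne
      obtain ⟨C, hC, h⟩ := hweight θ hθ
      obtain ⟨-, h1, h2⟩ := hdef j θ hθ
      rw [setIntegral_congr_fun (hKm j) h, integral_const_mul] at h2
      exact ⟨(integrable_const_mul_iff hC.ne'.isUnit _).1 (h1.congr_fun h (hKm j)),
        pos_of_mul_pos_right h2 hC.le⟩
    refine ⟨fun θ hθ => ?_, fun i hi => ?_⟩
    · have hstep : tailPrior I K j.castSucc θ =
          tailPrior I K j.succ θ * refFactor I K j (tailPrior I K j.succ) θ := by
        simp [tailPrior]
      have hset : Finset.univ.filter (fun i : Fin m => j.castSucc ≤ i.castSucc) =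
          insert j (Finset.univ.filter fun i : Fin m => j.succ ≤ i.castSucc) := by
        ext i
        simp [hlt, le_iff_eq_or_lt, eq_comm]
      -- `C` may vary with `θ` but is constant along `K j`, so it cancels against the normalizing
      -- integral.
      obtain ⟨C, hC, h⟩ := hweight θ hθ
      have hθj := h (θ j) (hθ j trivial)
      rw [Function.update_eq_self] at hθj
      rw [hset, Finset.prod_insert (by simp), hstep, ih1 θ hθ, mul_comm, refFactor,
        Set.indicator_of_mem (hθ j trivial), hθj, setIntegral_congr_fun (hKm j) h,
        integral_const_mul, mul_div_mul_left _ _ hC.ne']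
      rfl
    · rcases (Fin.castSucc_le_castSucc_iff.1 hi).eq_or_lt with rfl | h
      · exact hj
      · exact ih2 i ((hlt i).2 h)

theorem compactRefPrior_eq_prod (hKm : ∀ i, MeasurableSet (K i))
    (hdef : RefPriorDefined I K)
    (hdet : ∀ θ ∈ Set.univ.pi K, ∀ j, (cornerBlock (I θ) j).det = ∏ i, a j i (θ i))
    (ha : ∀ j i, ∀ x ∈ K i, a j i x ≠ 0) {θ : Param q} (hθ : θ ∈ Set.univ.pi K) :
    compactRefPrior I K θ = (∏ i, √|a i i (θ i)|) / ∏ i, ∫ x in K i, √|a i i x| ∧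
      0 < ∏ i, ∫ x in K i, √|a i i x| := by
  obtain ⟨h1, h2⟩ := tailPrior_eq_prod hKm ⟨θ, hθ⟩ hdef hdet ha 0
  refine ⟨?_, Finset.prod_pos fun i _ => (h2 i (Fin.zero_le _)).2⟩
  rw [compactRefPrior, h1 θ hθ, ← Finset.prod_div_distrib]
  simp [normalizedOn]

end ProductPrior

/-! ### Passage to the limit along the compact exhaustion. -/

section ReferencePriorLimit

variable {m : ℕ} {q : Fin m → ℕ} {I : Param q → Matrix (Coord q) (Coord q) ℝ}
  {Θ : (i : Fin m) → Set (Fin (q i) → ℝ)} {K : ℕ → (i : Fin m) → Set (Fin (q i) → ℝ)}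
  {a : (j i : Fin m) → (Fin (q i) → ℝ) → ℝ}

theorem eventually_mem_pi (hK : ∀ i, IsCompactExhaustion (Θ i) fun l => K l i) {θ : Param q}
    (hθ : θ ∈ Set.univ.pi Θ) : ∀ᶠ l in atTop, θ ∈ Set.univ.pi (K l) := by
  have h : ∀ i, ∀ᶠ l in atTop, θ i ∈ K l i := by
    intro i
    have hi := hθ i trivial
    rw [← (hK i).iUnion_eq, Set.mem_iUnion] at hi
    obtain ⟨l, hl⟩ := hi
    filter_upwards [eventually_ge_atTop l] with l' hl'
    exact (hK i).mono hl' hl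
  filter_upwards [eventually_all.2 h] with l hl i _ using hl i

/-- If the determinants of the `h_j` are products of nonvanishing functions `a j i` of the single
groups, the reference priors are the positive multiples of `∏ i, |a i i|^{1/2}`. -/
theorem isReferencePrior_iff (hΘ : ∀ i, (Θ i).Nonempty)
    (hK : ∀ i, IsCompactExhaustion (Θ i) fun l => K l i)
    (hdef : ∀ᶠ l in atTop, RefPriorDefined I (K l))
    (hdet : ∀ θ ∈ Set.univ.pi Θ, ∀ j, (cornerBlock (I θ) j).det = ∏ i, a j i (θ i))
    (ha : ∀ j i, ∀ x ∈ Θ i, a j i x ≠ 0) (π : Param q → ℝ) :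
    IsReferencePrior I (Set.univ.pi Θ) K π ↔
      ∃ c : ℝ, 0 < c ∧ ∀ θ ∈ Set.univ.pi Θ, π θ = c * ∏ i, √|a i i (θ i)| := by
  have hsub : ∀ l i, K l i ⊆ Θ i := fun l i => by
    rw [← (hK i).iUnion_eq]
    exact Set.subset_iUnion (fun l => K l i) l
  have hprior : ∀ θ ∈ Set.univ.pi Θ, ∀ᶠ l in atTop,
      compactRefPrior I (K l) θ = (∏ i, √|a i i (θ i)|) / ∏ i, ∫ x in K l i, √|a i i x| ∧
        0 < ∏ i, ∫ x in K l i, √|a i i x| := by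
    intro θ hθ
    filter_upwards [hdef, eventually_mem_pi hK hθ] with l hl hθl
    exact compactRefPrior_eq_prod (fun i => ((hK i).isCompact l).isClosed.measurableSet) hl
      (fun ϑ hϑ => hdet ϑ (Set.pi_mono (fun i _ => hsub l i) hϑ))
      (fun j i x hx => ha j i x (hsub l i hx)) hθl
  have hpos : ∀ θ ∈ Set.univ.pi Θ, 0 < ∏ i, √|a i i (θ i)| := fun θ hθ =>
    Finset.prod_pos fun i _ => Real.sqrt_pos.2 (abs_pos.2 (ha i i _ (hθ i trivial)))
  have hlim : ∀ θ₀ ∈ Set.univ.pi Θ, ∀ θ ∈ Set.univ.pi Θ,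
      Tendsto (fun l => compactRefPrior I (K l) θ / compactRefPrior I (K l) θ₀) atTop
        (𝓝 ((∏ i, √|a i i (θ i)|) / ∏ i, √|a i i (θ₀ i)|)) := by
    intro θ₀ hθ₀ θ hθ
    -- Once both points lie in the box, the normalizing products cancel, so the quotient no longer
    -- depends on `l`.
    refine tendsto_const_nhds.congr' ?_
    filter_upwards [hprior θ₀ hθ₀, hprior θ hθ] with l h₀ h
    rw [h₀.1, h.1, div_div_div_cancel_right₀ h.2.ne']
  constructor
  · rintro ⟨-, θ₀, hθ₀, -, c, hc, h⟩
    refine ⟨(c * ∏ i, √|a i i (θ₀ i)|)⁻¹, inv_pos.2 (mul_pos hc (hpos θ₀ hθ₀)), fun θ hθ => ?_⟩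
    have h1 := tendsto_nhds_unique (h θ hθ) (hlim θ₀ hθ₀ θ hθ)
    have h2 := (hpos θ₀ hθ₀).ne'
    field_simp at h1 ⊢
    linarith
  · rintro ⟨c, hc, h⟩
    choose θ₀ hθ₀ using hΘ
    have hθ₀' : θ₀ ∈ Set.univ.pi Θ := fun i _ => hθ₀ i
    refine ⟨hdef, θ₀, hθ₀', ?_, (c * ∏ i, √|a i i (θ₀ i)|)⁻¹,
      inv_pos.2 (mul_pos hc (hpos θ₀ hθ₀')), fun θ hθ => ?_⟩
    · filter_upwards [hprior θ₀ hθ₀'] with l hl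
      rw [hl.1]
      exact div_pos (hpos θ₀ hθ₀') hl.2
    · convert hlim θ₀ hθ₀' θ hθ using 2
      rw [h θ hθ]
      have h2 := (hpos θ₀ hθ₀').ne'
      field_simp

end ReferencePriorLimit

/-! ### Factors of product functions and the bound on `E(N)`. -/

section ProductInformation

variable {m : ℕ} {q : Fin m → ℕ}

theorem det_prod_ofFn {n : ℕ} {ι : Type*} [Fintype ι] [DecidableEq ι]
    (A : Fin n → Matrix ι ι ℝ) : ((List.ofFn A).prod).det = ∏ i, (A i).det := by
  rw [← Matrix.coe_detMonoidHom, map_list_prod, List.map_ofFn, List.prod_ofFn]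
  rfl

/-- A factor of a product function without zeros on a product of nonempty sets has no zeros. -/
theorem ne_zero_of_prod_ne_zero {Θ : (i : Fin m) → Set (Fin (q i) → ℝ)}
    (hΘ : ∀ i, (Θ i).Nonempty) {b : (i : Fin m) → (Fin (q i) → ℝ) → ℝ}
    (hb : ∀ θ ∈ Set.univ.pi Θ, ∏ i, b i (θ i) ≠ 0) (i : Fin m) {x : Fin (q i) → ℝ}
    (hx : x ∈ Θ i) : b i x ≠ 0 := by
  choose θ₀ hθ₀ using hΘ
  have h := Finset.prod_ne_zero_iff.1
    (hb (Function.update θ₀ i x) (update_mem_pi (fun i _ => hθ₀ i) hx)) i (Finset.mem_univ i)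
  rwa [Function.update_self] at h

/-- This bound makes `∏ g_i` positive, so that no `g_i` vanishes and `ENNReal.ofReal` loses nothing.
-/
theorem one_le_expectedStop {Ω : Type*} [MeasurableSpace Ω] {Pr : Param q → Measure Ω}
    {N : Ω → ℕ∞} {θ : Param q} [IsProbabilityMeasure (Pr θ)] (hN : ∀ ω, 1 ≤ N ω) :
    1 ≤ expectedStop Pr N θ := by
  calc (1 : ℝ≥0∞) = ∫⁻ _, 1 ∂(Pr θ) := by simp
    _ ≤ expectedStop Pr N θ := lintegral_mono fun ω => by
      simpa only [ENat.toENNReal_one] using ENat.toENNReal_le.2 (hN ω)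

end ProductInformation

/-! ### The main theorem. -/

theorem corollary2p2 {m : ℕ} {q : Fin m → ℕ}
    {Ω 𝓧 : Type*} [MeasurableSpace Ω] [MeasurableSpace 𝓧]
    (Θ : (i : Fin m) → Set (Fin (q i) → ℝ)) (hΘ : ∀ i, (Θ i).Nonempty)
    -- the regular family of densities and the i.i.d. sequence
    (μ : Measure 𝓧) (f : Param q → 𝓧 → ℝ) (hf : IsRegularFamily μ (Set.univ.pi Θ) f)
    (Pr : Param q → Measure Ω) (X : ℕ → Ω → 𝓧) (hX : ∀ n, Measurable (X n))
    (hiid : IsIIDSample μ (Set.univ.pi Θ) f Pr X)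
    -- the proper stopping time
    (N : Ω → ℕ∞) (hN : IsProperStoppingTime (Set.univ.pi Θ) Pr X hX N)
    -- the product structure of the Fisher information of a single observation
    (G : (l i : Fin m) → (Fin (q i) → ℝ) → Matrix (Fin (q l)) (Fin (q l)) ℝ)
    (hG : ∀ θ ∈ Set.univ.pi Θ, fisherInfo (densityLaw μ f) f θ =
      Matrix.blockDiagonal' fun l => (List.ofFn fun i => G l i (θ i)).prod)
    -- the product structure of the expected stopping time
    (g : (i : Fin m) → (Fin (q i) → ℝ) → ℝ)
    (hg : ∀ θ ∈ Set.univ.pi Θ, expectedStop Pr N θ = ENNReal.ofReal (∏ i, g i (θ i)))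
    -- all groups are two-dimensional
    (hq : ∀ i, q i = 2)
    -- the compact sets, on which both reference priors can be computed
    (K : ℕ → (i : Fin m) → Set (Fin (q i) → ℝ))
    (hK : ∀ i, IsCompactExhaustion (Θ i) fun l => K l i)
    (hfix : ∀ᶠ l in atTop, RefPriorDefined (fisherInfo (densityLaw μ f) f) (K l))
    (hseq : ∀ᶠ l in atTop, RefPriorDefined (fisherInfo Pr (seqLikelihood f X N)) (K l)) :
    IsReferencePrior (fisherInfo (densityLaw μ f) f) (Set.univ.pi Θ) K
        (fun θ => ∏ i, Real.sqrt |(G i i (θ i)).det|) ∧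
      ∀ πR : Param q → ℝ,
        IsReferencePrior (fisherInfo (densityLaw μ f) f) (Set.univ.pi Θ) K πR →
        ∀ πS : Param q → ℝ,
          IsReferencePrior (fisherInfo Pr (seqLikelihood f X N)) (Set.univ.pi Θ) K πS ↔
            ∃ c : ℝ, 0 < c ∧
              ∀ θ ∈ Set.univ.pi Θ, πS θ = c * ((expectedStop Pr N θ).toReal * πR θ) := by
  have hdetG : ∀ θ ∈ Set.univ.pi Θ, ∀ l,
      ((List.ofFn fun i => G l i (θ i)).prod).det ≠ 0 := fun θ hθ l => by
    have h := hf.posDef θ hθ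
    rw [hG θ hθ] at h
    exact h.det_ne_zero_of_blockDiagonal' l
  have hG0 : ∀ j i, ∀ x ∈ Θ i, (G j i x).det ≠ 0 := fun j i x hx =>
    ne_zero_of_prod_ne_zero hΘ (b := fun i x => (G j i x).det)
      (fun θ hθ => by rw [← det_prod_ofFn]; exact hdetG θ hθ j) i hx
  have hE1 : ∀ θ ∈ Set.univ.pi Θ, 1 ≤ ∏ i, g i (θ i) := fun θ hθ => by
    have := hiid.isProbabilityMeasure θ hθ
    have h := one_le_expectedStop (Pr := Pr) (θ := θ) hN.one_le
    rwa [hg θ hθ, ENNReal.one_le_ofReal] at h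
  have hEN : ∀ θ ∈ Set.univ.pi Θ, (expectedStop Pr N θ).toReal = ∏ i, g i (θ i) := fun θ hθ => by
    rw [hg θ hθ, ENNReal.toReal_ofReal (zero_le_one.trans (hE1 θ hθ))]
  have hg0 : ∀ i, ∀ x ∈ Θ i, g i x ≠ 0 := fun i x hx =>
    ne_zero_of_prod_ne_zero hΘ (fun θ hθ => (zero_lt_one.trans_le (hE1 θ hθ)).ne') i hx
  have hR := isReferencePrior_iff (a := fun j i x => (G j i x).det) hΘ hK hfix
    (fun θ hθ j => by
      rw [hG θ hθ, cornerBlock_blockDiagonal' (hdetG θ hθ), det_prod_ofFn]) hG0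
  -- The factor `g i x ^ 2` comes from `det (c • A) = c ^ q_j * det A` with `q_j = 2` and `c = ∏
  -- g_i`.
  have hS := isReferencePrior_iff (a := fun j i x => g i x ^ 2 * (G j i x).det) hΘ hK hseq
    (fun θ hθ j => by
      have hpos := (zero_lt_one.trans_le (hE1 θ hθ)).ne'
      rw [fisherInfo_seqLikelihood hf hiid hN hθ (by simp [hg θ hθ]), hG θ hθ, hEN θ hθ,
        ← Matrix.blockDiagonal'_smul, cornerBlock_blockDiagonal' fun l => by
          rw [Pi.smul_apply, Matrix.det_smul]
          exact mul_ne_zero (pow_ne_zero _ hpos) (hdetG θ hθ l)]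
      rw [Pi.smul_apply, Matrix.det_smul, Fintype.card_fin, det_prod_ofFn,
        Finset.prod_mul_distrib, Finset.prod_pow]
      exact congrArg (fun n => (∏ i, g i (θ i)) ^ n * _) (hq j))
    (fun j i x hx => mul_ne_zero (pow_ne_zero _ (hg0 i x hx)) (hG0 j i x hx))
  -- A single `g_i` may be negative; only the full product is known to be positive, so the absolute
  -- values are removed after multiplying.
  have hprod : ∀ θ ∈ Set.univ.pi Θ, ∏ i, √|g i (θ i) ^ 2 * (G i i (θ i)).det| =
      (expectedStop Pr N θ).toReal * ∏ i, √|(G i i (θ i)).det| := fun θ hθ => by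
    have h (i : Fin m) : √|g i (θ i) ^ 2 * (G i i (θ i)).det| =
        |g i (θ i)| * √|(G i i (θ i)).det| := by
      rw [abs_mul, abs_pow, Real.sqrt_mul (by positivity), Real.sqrt_sq (abs_nonneg _)]
    rw [hEN θ hθ, Finset.prod_congr rfl fun i _ => h i, Finset.prod_mul_distrib,
      ← Finset.abs_prod, abs_of_nonneg (zero_le_one.trans (hE1 θ hθ))]
  refine ⟨(hR _).2 ⟨1, one_pos, fun θ _ => (one_mul _).symm⟩, fun πR hπR πS => ?_⟩
  obtain ⟨c, hc, hπ⟩ := (hR πR).1 hπR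
  rw [hS πS]
  constructor
  · rintro ⟨d, hd, h⟩
    refine ⟨d / c, div_pos hd hc, fun θ hθ => ?_⟩
    rw [h θ hθ, hprod θ hθ, hπ θ hθ]
    field_simp
  · rintro ⟨d, hd, h⟩
    refine ⟨d * c, mul_pos hd hc, fun θ hθ => ?_⟩
    rw [h θ hθ, hprod θ hθ, hπ θ hθ]
    ring
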